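/- Let $\mathfrak A$ be a von Neumann algebra acting on a complex Hilbert space $\mathcal H$, i.e. a $*$-subalgebra of $\mathcal B(\mathcal H)$ containing the identity $I$ and equal to its double commutant. Assume that $\mathfrak A$ is properly infinite: the projection $I$ is infinite relative to $\mathfrak A$, and every nonzero projection in the center of $\mathfrak A$ is infinite relative to $\mathfrak A$. Here a projection $E \in \mathfrak A$ is infinite relative to $\mathfrak A$ if there are a projection $F \in \mathfrak A$ with $F \le E$, $F \ne E$, and an element $V \in \mathfrak A$ with $V^*V = E$ and $VV^* = F$. Then: 1. $\mathfrak A$ is not $*$-clean, i.e. it is not true that every element of $\mathfrak A$ is the sum of an invertible element of $\mathfrak A$ and a projection (self-adjoint idempotent) in $\mathfrak A$; 2. $\mathfrak A$ is not strongly clean, i.e. it is not true that every element of $\mathfrak A$ is the sum of an invertible element of $\mathfrak A$ and an idempotent in $\mathfrak A$ that commute with each other. -/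

import Mathlib

namespace CleanVN

section Cleanness

/-- A ring is strongly clean if every element is the sum of an invertible element and an
idempotent that commute with each other. -/
def IsStronglyClean (R : Type*) [Ring R] : Prop :=
  ∀ a : R, ∃ u q : R, IsUnit u ∧ IsIdempotentElem q ∧ Commute u q ∧ a = u + q

/-- A `*`-ring is `*`-clean if every element is the sum of an invertible element and a
projection (a self-adjoint idempotent). -/
def IsStarClean (R : Type*) [Ring R] [StarRing R] : Prop :=
  ∀ a : R, ∃ u p : R, IsUnit u ∧ IsStarProjection p ∧ a = u + p

end Cleanness

section Comparison

variable {R : Type*} [Ring R] [StarRing R]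

/-- Murray--von Neumann equivalence of projections relative to `R`: there is a partial isometry
`v` in `R` with initial projection `e` and final projection `f`. -/
def MvNEquiv (e f : R) : Prop :=
  ∃ v : R, star v * v = e ∧ v * star v = f

/-- A projection `e` is infinite relative to `R` if it is equivalent to a proper
subprojection `f` of itself (`f ≤ e` is expressed by `e * f = f`). -/
def IsInfiniteProj (e : R) : Prop :=
  IsStarProjection e ∧ ∃ f : R, IsStarProjection f ∧ e * f = f ∧ f ≠ e ∧ MvNEquiv e f

/-- A projection `e` is properly infinite relative to `R` if it is infinite and, for each central
projection `p` of `R`, the projection `p * e` is either zero or infinite. -/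
def IsProperlyInfiniteProj (e : R) : Prop :=
  IsInfiniteProj e ∧
    ∀ p : R, IsStarProjection p → p ∈ Set.center R → p * e = 0 ∨ IsInfiniteProj (p * e)

end Comparison

/-- A von Neumann algebra is properly infinite if its identity is a properly infinite projection
relative to the algebra: all projections and partial isometries are taken in the algebra `A`. -/
def IsProperlyInfinite {H : Type*} [NormedAddCommGroup H] [InnerProductSpace ℂ H]
    [CompleteSpace H] (A : VonNeumannAlgebra H) : Prop :=
  IsProperlyInfiniteProj (1 : A)

end CleanVN

namespace CleanVN

section CStar

/-! Infiniteness of `I` supplies a non-unitary isometry `v`, which is neither kind of sum. If `v -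
p` is invertible with `p` a projection, so is `v - t p` for some `t < 1`; then `v* (v - t p) = 1 - t
v* p` is invertible by the Neumann series, hence so is `v`. If `v` commutes with an idempotent `q`,
the projection case applied on the range of `q` makes `v` onto there, while on `ker q` it equals the
invertible `v - q`. -/

theorem norm_le_one_of_star_mul_self_eq_one {B : Type*} [NormedRing B] [StarRing B] [CStarRing B]
    {v : B} (hv : star v * v = 1) : ‖v‖ ≤ 1 := by
  have h : ‖v‖ * ‖v‖ ≤ 1 := by
    rw [← CStarRing.norm_star_mul_self, hv]
    exact IsStarProjection.norm_le 1 (.one _)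
  nlinarith [norm_nonneg v]

variable {B : Type*} [NormedRing B] [CompleteSpace B] [StarRing B] [CStarRing B]

/-- An isometry at distance less than one from a unit is itself a unit. -/
theorem isUnit_of_isUnit_sub {v b : B} (hv : star v * v = 1) (hb : ‖b‖ < 1)
    (hu : IsUnit (v - b)) : IsUnit v := by
  have hn : ‖star v * b‖ < 1 := by
    refine (norm_mul_le _ _).trans_lt ?_
    rw [norm_star]
    nlinarith [norm_le_one_of_star_mul_self_eq_one hv, norm_nonneg b, norm_nonneg v]
  have h1 : IsUnit (star v * (v - b)) := by
    rw [mul_sub, hv]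
    exact isUnit_one_sub_of_norm_lt_one hn
  obtain ⟨w, hw⟩ := hu
  rw [← hw, Units.isUnit_mul_units] at h1
  exact isUnit_star.mp h1

/-- An isometry differing from a unit by a projection `e` is a unit: the units are open, so
`w - t • e` is a unit for some `t < 1`. -/
theorem isUnit_of_isUnit_sub_projection [NormedAlgebra ℝ B] {w e : B} (hw : star w * w = 1)
    (he : IsStarProjection e) (hu : IsUnit (w - e)) : IsUnit w := by
  have hc : Continuous fun t : ℝ => w - t • e := by fun_prop
  have ho : IsOpen {t : ℝ | IsUnit (w - t • e)} := Units.isOpen.preimage hc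
  have h1 : ∀ᶠ t in nhdsWithin (1 : ℝ) (Set.Iio 1), IsUnit (w - t • e) :=
    mem_nhdsWithin_of_mem_nhds (ho.mem_nhds (by simpa using hu))
  have h2 : ∀ᶠ t in nhdsWithin (1 : ℝ) (Set.Iio 1), t ∈ Set.Ioo (0 : ℝ) 1 :=
    Ioo_mem_nhdsLT one_pos
  obtain ⟨t, ht, ht0, ht1⟩ := (h1.and h2).exists
  refine isUnit_of_isUnit_sub hw ?_ ht
  rw [norm_smul, Real.norm_of_nonneg ht0.le]
  nlinarith [IsStarProjection.norm_le e he, norm_nonneg e]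

/-- An isometry which is strongly clean is a unit, provided the idempotent has the same range as
a projection. -/
theorem isUnit_of_isUnit_sub_idempotent [NormedAlgebra ℝ B] {v q e : B} (hv : star v * v = 1)
    (he : IsStarProjection e) (hq : IsIdempotentElem q) (hqe : q * e = e) (heq : e * q = q)
    (hc : Commute v q) (hu : IsUnit (v - q)) : IsUnit v := by
  obtain ⟨u, hu⟩ := hu
  set s : B := (↑u⁻¹ : B) with hs
  have hus : (v - q) * s = 1 := by rw [← hu]; exact u.mul_inv
  have hsu : s * (v - q) = 1 := by rw [← hu]; exact u.inv_mul
  have hqs : q * s = s * q := by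
    have : Commute (u : B) q := by rw [hu]; exact hc.sub_left (Commute.refl q)
    exact (this.units_inv_left).eq.symm
  have hee : e * e = e := he.isIdempotentElem
  have hse : star e = e := he.isSelfAdjoint
  -- The range of `e`, being that of `q`, is invariant under `v` and under `s`, as both commute with
  -- `q`.
  have heve : e * v * e = v * e := by
    calc e * v * e = e * (v * q) * e := by simp only [mul_assoc, hqe]
      _ = e * q * (v * e) := by rw [hc.eq]; simp only [mul_assoc]
      _ = q * v * e := by rw [heq, mul_assoc]
      _ = v * e := by rw [← hc.eq, mul_assoc, hqe]
  have hese : e * s * e = s * e := by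
    calc e * s * e = e * (s * q) * e := by simp only [mul_assoc, hqe]
      _ = e * q * (s * e) := by rw [← hqs]; simp only [mul_assoc]
      _ = q * s * e := by rw [heq, mul_assoc]
      _ = s * e := by rw [hqs, mul_assoc, hqe]
  have heve' : e * star v * e = e * star v := by
    have := congrArg star heve
    simpa [hse, mul_assoc] using this
  have hvqe : (v - q) * e = (v - 1) * e := by rw [sub_mul, hqe, sub_mul, one_mul]
  -- `v` on the range of `e`, extended by the identity on its orthogonal complement.
  set w : B := v * e + (1 - e) with hwdef
  have hw : star w * w = 1 := by
    have h1 : e * star v * (v * e) = e := by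
      rw [mul_assoc, ← mul_assoc (star v), hv, one_mul, hee]
    have h2 : e * star v * (1 - e) = 0 := by rw [mul_sub, heve', mul_one, sub_self]
    have h3 : (1 - e) * (v * e) = 0 := by rw [sub_mul, ← mul_assoc, ← mul_assoc, heve, one_mul, sub_self]
    have h4 : (1 - e) * (1 - e) = 1 - e := he.isIdempotentElem.one_sub
    have h5 : star w = e * star v + (1 - e) := by simp [hwdef, hse]
    rw [h5, hwdef, add_mul, mul_add, mul_add, h1, h2, h3, h4]
    abel
  have hwe : w - e = (v - q) * e + (1 - e) := by
    rw [hvqe, hwdef]; noncomm_ring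
  have heue : e * ((v - q) * e) = (v - q) * e := by
    rw [sub_mul, mul_sub, ← mul_assoc, heve, hqe, hee]
  have hue : IsUnit (w - e) := by
    have h0 : e * (1 - e) = 0 := by rw [mul_sub, mul_one, hee, sub_self]
    have h4 : (1 - e) * (1 - e) = 1 - e := he.isIdempotentElem.one_sub
    have h1 : (1 - e) * (s * e) = 0 := by
      rw [sub_mul, ← mul_assoc, ← mul_assoc, hese, one_mul, sub_self]
    have h2 : (1 - e) * ((v - q) * e) = 0 := by rw [sub_mul, heue, one_mul, sub_self]
    rw [hwe, isUnit_iff_exists]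
    refine ⟨s * e + (1 - e), ?_, ?_⟩
    · rw [add_mul, mul_add, mul_add, h1, h4, mul_assoc _ e (1 - e), h0, mul_zero, mul_assoc,
        ← mul_assoc e, hese, ← mul_assoc, hus]
      noncomm_ring
    · rw [add_mul, mul_add, mul_add, h2, h4, mul_assoc _ e (1 - e), h0, mul_zero, mul_assoc,
        heue, ← mul_assoc, hsu]
      noncomm_ring
  obtain ⟨y, hwy, -⟩ := isUnit_iff_exists.mp (isUnit_of_isUnit_sub_projection hw he hue)
  have hew : e * w = v * e := by
    rw [hwdef, mul_add, mul_sub, mul_one, hee, sub_self, add_zero, ← mul_assoc, heve]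
  have h1 : v * (e * y * q) = q := by
    calc v * (e * y * q) = v * e * y * q := by simp only [mul_assoc]
      _ = e * (w * y) * q := by rw [← hew]; simp only [mul_assoc]
      _ = q := by rw [hwy, mul_one, heq]
  have h2 : v * (s * (1 - q)) = 1 - q := by
    have hqq : q * (1 - q) = 0 := by rw [mul_sub, mul_one, hq.eq, sub_self]
    calc v * (s * (1 - q)) = (v - q) * s * (1 - q) + q * s * (1 - q) := by noncomm_ring
      _ = 1 - q := by rw [hus, hqs, mul_assoc s, hqq, mul_zero, add_zero, one_mul]
  -- The inverses on the range and on the kernel of `q` glue to a right inverse of `v`.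
  have hr : v * (e * y * q + s * (1 - q)) = 1 := by rw [mul_add, h1, h2, add_sub_cancel]
  refine isUnit_iff_exists.mpr ⟨_, hr, ?_⟩
  rwa [← left_inv_eq_right_inv hv hr]

end CStar
/-- A bounded idempotent on a Hilbert space has the same range as some orthogonal projection. -/
theorem exists_isStarProjection_of_isIdempotentElem {H : Type*} [NormedAddCommGroup H]
    [InnerProductSpace ℂ H] [CompleteSpace H] {q : H →L[ℂ] H} (hq : IsIdempotentElem q) :
    ∃ e : H →L[ℂ] H, IsStarProjection e ∧ q * e = e ∧ e * q = q := by
  let K : Submodule ℂ H := (1 - q : H →L[ℂ] H).ker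
  have hK : ∀ x, x ∈ K ↔ q x = x := fun x => by
    simp [K, LinearMap.mem_ker, sub_eq_zero, eq_comm (a := x)]
  have hKc : IsClosed (K : Set H) := (1 - q : H →L[ℂ] H).isClosed_ker
  have : CompleteSpace K := hKc.completeSpace_coe
  refine ⟨K.starProjection, isStarProjection_starProjection, ?_, ?_⟩
  · ext x
    exact (hK _).mp (K.starProjection_apply_mem x)
  · ext x
    refine Submodule.starProjection_eq_self_iff.mpr ((hK _).mpr ?_)
    exact DFunLike.congr_fun hq x

end CleanVN

theorem lemma2p1 {H : Type*} [NormedAddCommGroup H] [InnerProductSpace ℂ H] [CompleteSpace H]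
    (A : VonNeumannAlgebra H) (hA : CleanVN.IsProperlyInfinite A) :
    ¬ CleanVN.IsStarClean A ∧ ¬ CleanVN.IsStronglyClean A := by
  obtain ⟨-, f, -, -, hf, v, hv, hvf⟩ := hA.1
  have hv' : star (v : H →L[ℂ] H) * v = 1 := congrArg Subtype.val hv
  -- Non-invertibility holds in all of `B(H)`, so range projections need not be shown to lie in `A`.
  have key : ¬ IsUnit (v : H →L[ℂ] H) := by
    intro h
    obtain ⟨r, hr, -⟩ := isUnit_iff_exists.mp h
    refine hf (hvf.symm.trans (Subtype.ext ?_))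
    change (v : H →L[ℂ] H) * star (v : H →L[ℂ] H) = 1
    rwa [left_inv_eq_right_inv hv' hr]
  have hunit : ∀ {u : A}, IsUnit u → IsUnit (u : H →L[ℂ] H) := fun h =>
    h.map (SubringClass.subtype A)
  refine ⟨fun hc => key ?_, fun hc => key ?_⟩
  · obtain ⟨u, p, hu, hp, h⟩ := hc v
    have hp' : IsStarProjection (p : H →L[ℂ] H) :=
      ⟨congrArg Subtype.val hp.isIdempotentElem, congrArg Subtype.val hp.isSelfAdjoint⟩
    refine CleanVN.isUnit_of_isUnit_sub_projection hv' hp' ?_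
    have h' : (v : H →L[ℂ] H) = u + p := congrArg Subtype.val h
    rw [h', add_sub_cancel_right]
    exact hunit hu
  · obtain ⟨u, q, hu, hq, hcomm, h⟩ := hc v
    have hq' : IsIdempotentElem (q : H →L[ℂ] H) := congrArg Subtype.val hq
    have h' : (v : H →L[ℂ] H) = u + q := congrArg Subtype.val h
    have hcomm' : Commute (u : H →L[ℂ] H) q := congrArg Subtype.val hcomm.eq
    obtain ⟨e, he, hqe, heq⟩ := CleanVN.exists_isStarProjection_of_isIdempotentElem hq'
    refine CleanVN.isUnit_of_isUnit_sub_idempotent hv' he hq' hqe heq ?_ ?_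
    · rw [h']
      exact hcomm'.add_left (Commute.refl _)
    · rw [h', add_sub_cancel_right]
      exact hunit hu
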